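/- All graphs are simple. For a graph $G$, a set $X$ of vertices and a set $Y$ of edges of $G$, let $G\setminus(X\cup Y)$ be the subgraph of $(V(G),E(G)\setminus Y)$ induced on $V(G)\setminus X$. Let $p,q\ge 0$ be integers, not both $0$. A graph $G$ is called $(p,q)$-connected if it has at least $p+q+1$ vertices and - in case $q=0$: $G$ remains connected after removal of any at most $p-1$ vertices; - in case $q>0$: $G$ remains connected after removal of any at most $p$ vertices and any at most $q-1$ edges. The Cartesian product $G_1\Box\cdots\Box G_n$ has vertex set $V(G_1)\times\cdots\times V(G_n)$; two vertices are adjacent if their entries in some coordinate $i$ are adjacent in $G_i$ and their entries in all other coordinates coincide. Corollary 4.7. Let $n\ge 1$, let $G_i$ be a $(p_i,q_i)$-connected graph for $i=1,\dots,n$ (with $p_i,q_i\ge0$ integers, $(p_i,q_i)\ne(0,0)$), and let $k$ be the number of indices $i$ with $q_i>0$. Then the Cartesian product $G_1\Box G_2\Box\cdots\Box G_n$ is 1. $\left(\sum_{i=1}^n p_i,\ \sum_{i=1}^n q_i\right)$-connected, and 2. if $k\ge 1$, also $\left(\sum_{i=1}^n p_i+k-1,\ \sum_{i=1}^n q_i-k+1\right)$-connected.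 -/

import Mathlib

/-- The Cartesian product of a family of simple graphs: two vertices are adjacent iff they are
adjacent in exactly one coordinate and agree in all the others. -/
def cartesianProduct {ι : Type*} {V : ι → Type*} (G : ∀ i, SimpleGraph (V i)) :
    SimpleGraph (∀ i, V i) where
  Adj x y := ∃ i, (G i).Adj (x i) (y i) ∧ ∀ j, j ≠ i → x j = y j
  symm := ⟨fun _ _ ⟨i, hi, h⟩ => ⟨i, hi.symm, fun j hj => (h j hj).symm⟩⟩
  loopless := ⟨fun _ ⟨_, hi, _⟩ => hi.ne rfl⟩

/-- `G` with the set `X` of vertices and the set `Y` of edges removed: the subgraph of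
`(V, E \ Y)` induced on `V \ X`. -/
def removeElements {V : Type*} (G : SimpleGraph V) (X : Set V) (Y : Set (Sym2 V)) :
    SimpleGraph (Xᶜ : Set V) :=
  (G.deleteEdges Y).induce Xᶜ

/-- `(p, q)`-connectedness.
* `q = 0`, `p > 0`: `G` remains connected after the removal of any (at most) `p - 1` vertices.
* `q > 0`: `G` remains connected after the removal of any (at most) `p` vertices and
  any (at most) `q - 1` edges.

As for the usual vertex connectivity (where the complete graph on `n` vertices is
`(n - 1)`-connected but not `n`-connected), `G` has to have more than `p + q` vertices.
The notion is not defined for `p = q = 0`, where the predicate is false. -/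
def MixedConnected {V : Type*} (G : SimpleGraph V) (p q : ℕ) : Prop :=
  ((p + q : ℕ) : ℕ∞) < ENat.card V ∧
    ((q = 0 ∧ 0 < p ∧
        ∀ X : Finset V, X.card ≤ p - 1 → (removeElements G X ∅).Connected) ∨
      (0 < q ∧
        ∀ (X : Finset V) (Y : Finset (Sym2 V)), (Y : Set (Sym2 V)) ⊆ G.edgeSet →
          X.card ≤ p → Y.card ≤ q - 1 → (removeElements G X Y).Connected))

/-! Call (a, b) in `CutConnected G a b` the budget of G. A (p, q)-connected graph has budget (p, q -
1) if q > 0, and (p - 1, 0) if q = 0. In a product, budgets add with a bonus of one vertex: (a, b)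
and (c, d) give (a + c + 1, b + d), by `CutConnected.boxProd`. Iterating this yields the second
claim, and trading vertices for edges (`CutConnected.shift`) then yields the first; for k = 0 the
iteration is itself the first claim.

For two factors, deleting an edge from a factor costs it one unit of budget and shrinks the cut by
at least one edge. Up to symmetry this leaves a cut with at most b removed edges, all in the
direction of H (`IsBoxCut.false_of_left_empty`). A bichromatic G-layer uses up more than a removed
vertices, and degree counts in both factors exclude the rest. Without one, all H-layers are
monochromatic too, and too many layers must contain removed vertices. -/

/-- A colouring `f` of the vertices of `G` by two colours, undefined at most on the finite set `X`,
in which both colours occur and every bichromatic edge belongs to the finite set `Y`: a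
certificate that `G` becomes disconnected when `X` and `Y` are removed. -/
structure IsMixedCut {V : Type*} (G : SimpleGraph V) (f : V → Option Bool) (X : Finset V)
    (Y : Finset (Sym2 V)) : Prop where
  none_mem : ∀ v, f v = none → v ∈ X
  edge_mem : ∀ u v, G.Adj u v → f u = some true → f v = some false → s(u, v) ∈ Y
  exists_true : ∃ v, f v = some true
  exists_false : ∃ v, f v = some false

/-- `G` has at least `a + b + 2` vertices and no removal of at most `a` vertices and at most `b`
edges disconnects it. -/
def CutConnected {V : Type*} (G : SimpleGraph V) (a b : ℕ) : Prop :=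
  (∃ A : Finset V, a + b + 2 ≤ A.card) ∧
    ∀ f X Y, IsMixedCut G f X Y → X.card ≤ a → b < Y.card

/-! ### Cuts of a single graph: trading vertices for edges, degrees -/

namespace CutConnected

variable {V : Type*} {G : SimpleGraph V} {a b : ℕ}

theorem mono_right (h : CutConnected G a b) {b' : ℕ} (hb : b' ≤ b) : CutConnected G a b' := by
  obtain ⟨⟨A, hA⟩, h⟩ := h
  exact ⟨⟨A, by omega⟩, fun f X Y hf hX => hb.trans_lt (h f X Y hf hX)⟩

/-- One removed vertex may be traded for one removed edge. -/
theorem shift (h : CutConnected G (a + 1) b) : CutConnected G a (b + 1) := by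
  classical
  obtain ⟨⟨A, hA⟩, h⟩ := h
  refine ⟨⟨A, by omega⟩, fun f X Y hf hX => ?_⟩
  by_contra! hY
  by_cases hex : ∃ u v, G.Adj u v ∧ f u = some true ∧ f v = some false
  · obtain ⟨u, v, huv, hu, hv⟩ := hex
    have hmem := hf.edge_mem u v huv hu hv
    have hYc : (Y.erase s(u, v)).card ≤ b := by
      rw [Finset.card_erase_of_mem hmem]; omega
    -- Removing the endpoint w instead of the edge uv gives a cut that is too small, unless w is the
    -- only vertex of its colour.
    have key : ∀ w, w = u ∨ w = v →
        ¬ ((∃ z, z ≠ w ∧ f z = some true) ∧ ∃ z, z ≠ w ∧ f z = some false) := by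
      rintro w hw ⟨⟨z, hzw, hz⟩, ⟨z', hzw', hz'⟩⟩
      have hc : IsMixedCut G (Function.update f w none) (insert w X) (Y.erase s(u, v)) := by
        refine ⟨fun x hx => ?_, fun x y hxy hx hy => ?_, ⟨z, by simp [hzw, hz]⟩,
          ⟨z', by simp [hzw', hz']⟩⟩
        · by_cases hxw : x = w
          · simp [hxw]
          · rw [Function.update_of_ne hxw] at hx
            exact Finset.mem_insert_of_mem (hf.none_mem x hx)
        · have hxw : x ≠ w := by rintro rfl; simp at hx
          have hyw : y ≠ w := by rintro rfl; simp at hy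
          rw [Function.update_of_ne hxw] at hx
          rw [Function.update_of_ne hyw] at hy
          refine Finset.mem_erase.2 ⟨fun he => ?_, hf.edge_mem x y hxy hx hy⟩
          have : w ∈ s(x, y) := by rw [he]; simpa using hw
          rcases Sym2.mem_iff.1 this with h | h
          · exact hxw h.symm
          · exact hyw h.symm
      have := h _ _ _ hc ((Finset.card_insert_le _ _).trans (by omega))
      omega
    have hne : u ≠ v := huv.ne
    have h1 : ∀ z, f z = some true → z = u := by
      intro z hz
      by_contra hzu
      exact key u (Or.inl rfl) ⟨⟨z, hzu, hz⟩, ⟨v, hne.symm, hv⟩⟩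
    have h2 : ∀ z, f z = some false → z = v := by
      intro z hz
      by_contra hzv
      exact key v (Or.inr rfl) ⟨⟨u, hne, hu⟩, ⟨z, hzv, hz⟩⟩
    -- Only u and v are coloured, so G has at most a + 2 vertices: too few.
    have hsub : A ⊆ insert u (insert v X) := by
      intro z _
      rcases hz : f z with _ | _ | _
      · simp [hf.none_mem z hz]
      · simp [h2 z hz]
      · simp [h1 z hz]
    have := Finset.card_le_card hsub
    have := Finset.card_insert_le u (insert v X)
    have := Finset.card_insert_le v X
    omega
  · push Not at hex
    have := h f X ∅ ⟨hf.none_mem, fun u v huv hu hv => absurd hv (hex u v huv hu),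
      hf.exists_true, hf.exists_false⟩ (by omega)
    simp at this

theorem shift_add (m : ℕ) : ∀ {a b : ℕ}, CutConnected G (a + m) b → CutConnected G a (b + m) := by
  induction m with
  | zero => exact fun h => h
  | succ m ih =>
    intro a b h
    have := (ih (a := a + 1) (by rwa [add_assoc, add_comm 1 m])).shift
    rwa [add_assoc] at this

/-- A cut using at most `a` vertices uses at least `a + b + 1` vertices and edges in total. -/
theorem lt_card_add_card (h : CutConnected G a b) {f : V → Option Bool} {X : Finset V}
    {Y : Finset (Sym2 V)} (hf : IsMixedCut G f X Y) (hX : X.card ≤ a) :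
    a + b < X.card + Y.card := by
  -- The vertices that `X` leaves unused are traded for edges.
  have h' : CutConnected G X.card (b + (a - X.card)) :=
    shift_add _ (by rwa [Nat.add_sub_cancel' hX])
  have := h'.2 f X Y hf le_rfl
  omega

/-- Every vertex has at least `a + b + 1` neighbours. -/
theorem lt_card_of_neighbor_mem (h : CutConnected G a b) (v : V) (N : Finset V)
    (hN : ∀ w, G.Adj v w → w ∈ N) : a + b < N.card := by
  classical
  obtain ⟨A, hA⟩ := h.1
  obtain ⟨z, -, hz⟩ := Finset.exists_mem_ne (by omega : 1 < A.card) v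
  -- The star at v separates v from everything else.
  have hc : IsMixedCut G (fun w => some (decide (w = v))) ∅ (N.image fun w => s(v, w)) := by
    refine ⟨by simp, fun x y hxy hx hy => ?_, ⟨v, by simp⟩, ⟨z, by simp [hz]⟩⟩
    obtain rfl : x = v := by simpa using hx
    exact Finset.mem_image_of_mem _ (hN y hxy)
  have := h.lt_card_add_card hc (by simp)
  have := Finset.card_image_le (s := N) (f := fun w => s(v, w))
  simp only [Finset.card_empty] at *
  omega

theorem deleteEdge (h : CutConnected G a (b + 1)) (e : Sym2 V) :
    CutConnected (G.deleteEdges {e}) a b := by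
  classical
  obtain ⟨⟨A, hA⟩, h⟩ := h
  refine ⟨⟨A, by omega⟩, fun f X Y hf hX => ?_⟩
  have := h f X (insert e Y) ⟨hf.none_mem, fun u v huv hu hv => ?_, hf.exists_true,
    hf.exists_false⟩ hX
  · have := Finset.card_insert_le e Y
    omega
  · by_cases he : s(u, v) = e
    · simp [he]
    · exact Finset.mem_insert_of_mem (hf.edge_mem u v (by simp [huv, he]) hu hv)

theorem of_iso {W : Type*} {H : SimpleGraph W} (e : G ≃g H) (h : CutConnected G a b) :
    CutConnected H a b := by
  classical
  obtain ⟨⟨A, hA⟩, h⟩ := h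
  refine ⟨⟨A.map e.toEquiv.toEmbedding, by simpa using hA⟩, fun f X Y hf hX => ?_⟩
  have := h (f ∘ e) (X.image e.symm) (Y.image (Sym2.map e.symm)) ⟨fun v hv => ?_,
    fun u v huv hu hv => ?_, ?_, ?_⟩ (Finset.card_image_le.trans hX)
  · exact this.trans_le Finset.card_image_le
  · exact Finset.mem_image.2 ⟨e v, hf.none_mem _ hv, by simp⟩
  · exact Finset.mem_image.2 ⟨s(e u, e v), hf.edge_mem _ _ (e.map_adj_iff.2 huv) hu hv, by simp⟩
  · obtain ⟨v, hv⟩ := hf.exists_true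
    exact ⟨e.symm v, by simpa using hv⟩
  · obtain ⟨v, hv⟩ := hf.exists_false
    exact ⟨e.symm v, by simpa using hv⟩

/-- The cut formulation agrees with connectedness after removal of vertices and edges. -/
theorem iff_removeElements_connected : CutConnected G a b ↔
    (((a + b + 1 : ℕ) : ℕ∞) < ENat.card V ∧
      ∀ (X : Finset V) (Y : Finset (Sym2 V)), (Y : Set (Sym2 V)) ⊆ G.edgeSet →
        X.card ≤ a → Y.card ≤ b → (removeElements G X Y).Connected) := by
  classical
  have hcard : (∃ A : Finset V, a + b + 2 ≤ A.card) ↔ ((a + b + 1 : ℕ) : ℕ∞) < ENat.card V := by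
    rw [← Set.encard_univ]
    constructor
    · rintro ⟨A, hA⟩
      have h1 := Set.encard_le_encard (Set.subset_univ (A : Set V))
      rw [Set.encard_coe_eq_coe_finsetCard] at h1
      exact lt_of_lt_of_le (by exact_mod_cast (by omega : a + b + 1 < A.card)) h1
    · intro h
      obtain ⟨t, -, ht⟩ := Set.exists_subset_encard_eq (Order.add_one_le_of_lt h)
      have hfin : t.Finite := Set.finite_of_encard_eq_coe (k := a + b + 1 + 1) (by exact_mod_cast ht)
      refine ⟨hfin.toFinset, ?_⟩
      rw [hfin.encard_eq_coe_toFinset_card] at ht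
      have : hfin.toFinset.card = a + b + 1 + 1 := by exact_mod_cast ht
      omega
  refine and_congr_left' hcard |>.trans (and_congr_right fun hV => ⟨fun h X Y hYG hX hY => ?_,
    fun h f X Y hf hX => ?_⟩)
  · obtain ⟨A, hA⟩ := hcard.2 hV
    obtain ⟨z, -, hz⟩ := Finset.exists_mem_notMem_of_card_lt_card (by omega : X.card < A.card)
    have : Nonempty ((X : Set V)ᶜ : Set V) := ⟨⟨z, by simpa using hz⟩⟩
    refine SimpleGraph.Connected.mk fun u v => ?_
    by_contra huv
    let f : V → Option Bool := fun w =>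
      if hw : w ∈ ((X : Set V)ᶜ : Set V) then
        some (decide ((removeElements G X Y).Reachable u ⟨w, hw⟩)) else none
    have hf : ∀ (w : V) (hw : w ∈ ((X : Set V)ᶜ : Set V)),
        f w = some (decide ((removeElements G X Y).Reachable u ⟨w, hw⟩)) := fun w hw => dif_pos hw
    refine absurd (h f X Y ⟨fun w hw => ?_, fun w z hwz hw hz => ?_, ⟨u, ?_⟩, ⟨v, ?_⟩⟩ hX)
      (by omega)
    · by_contra hwX
      rw [hf w (by simpa using hwX)] at hw
      simp at hw
    · by_contra hY'
      have hwX : w ∈ ((X : Set V)ᶜ : Set V) := by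
        by_contra hc
        rw [show f w = none from dif_neg hc] at hw
        simp at hw
      have hzX : z ∈ ((X : Set V)ᶜ : Set V) := by
        by_contra hc
        rw [show f z = none from dif_neg hc] at hz
        simp at hz
      rw [hf w hwX] at hw
      rw [hf z hzX] at hz
      simp only [Option.some.injEq, decide_eq_true_eq, decide_eq_false_iff_not] at hw hz
      refine hz (hw.trans (SimpleGraph.Adj.reachable ?_))
      simp [removeElements, hwz, hY']
    · rw [hf _ u.2]; simp
    · rw [hf _ v.2]; simpa using huv
  · by_contra! hY
    obtain ⟨u, hu⟩ := hf.exists_true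
    obtain ⟨v, hv⟩ := hf.exists_false
    have hmem : ∀ w, w ∈ (((X.filter fun w => f w = none : Finset V) : Set V)ᶜ : Set V) ↔
        f w ≠ none := by
      intro w
      simp only [Finset.coe_filter, Set.mem_compl_iff, Set.mem_ofPred_eq, not_and]
      exact ⟨fun h hw => h (hf.none_mem w hw) hw, fun h _ => h⟩
    -- `X` may contain coloured vertices, even u or v, and `Y` may contain non-edges; these are
    -- discarded first.
    have hconn := h (X.filter fun w => f w = none) (Y.filter fun e => e ∈ G.edgeSet)
      (by intro e he; simpa using (Finset.mem_filter.1 he).2)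
      ((Finset.card_filter_le _ _).trans hX) ((Finset.card_filter_le _ _).trans hY)
    have hr := hconn.preconnected ⟨u, (hmem u).2 (by simp [hu])⟩ ⟨v, (hmem v).2 (by simp [hv])⟩
    rw [SimpleGraph.reachable_iff_reflTransGen] at hr
    have key : f v = some true := by
      suffices ∀ z, Relation.ReflTransGen
          (removeElements G (X.filter fun w => f w = none : Finset V)
            (Y.filter fun e => e ∈ G.edgeSet : Finset (Sym2 V))).Adj
          ⟨u, (hmem u).2 (by simp [hu])⟩ z → f z = some true from this _ hr
      intro z hz
      induction hz with
      | refl => exact hu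
      | @tail y z _ hyz ih =>
        have hz := (hmem z).1 z.2
        rcases hfz : f z with _ | _ | _
        · exact absurd hfz hz
        · simp only [removeElements, SimpleGraph.comap_adj, SimpleGraph.deleteEdges_adj,
            Function.Embedding.subtype_apply] at hyz
          exact absurd (Finset.mem_coe.2 (Finset.mem_filter.2
            ⟨hf.edge_mem _ _ hyz.1 ih hfz, by simpa using hyz.1⟩)) hyz.2
        · rfl
    simp [key] at hv

end CutConnected

/-! ### Cuts of the product of two graphs -/

theorem Finset.card_fiber_add_card_image_erase_le {α β : Type*} [DecidableEq β] (Z : Finset α)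
    (π : α → β) (z : β) :
    (Z.filter fun x => π x = z).card + ((Z.image π).erase z).card ≤ Z.card := by
  classical
  rw [← Finset.card_filter_add_card_filter_not (s := Z) fun x => π x = z]
  gcongr
  refine (Finset.card_le_card fun y hy => ?_).trans
    (Finset.card_image_le (s := Z.filter fun x => ¬ π x = z) (f := π))
  simp only [Finset.mem_erase, Finset.mem_image, Finset.mem_filter] at hy ⊢
  obtain ⟨hyz, x, hx, rfl⟩ := hy
  exact ⟨x, ⟨hx, hyz⟩, rfl⟩

/-- A mixed cut of the Cartesian product of `G` and `H`; its edges are given as a set `E` of edges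
in the direction of `G` and a set `F` of edges in the direction of `H`. -/
structure IsBoxCut {V W : Type*} (G : SimpleGraph V) (H : SimpleGraph W)
    (f : V → W → Option Bool) (X : Finset (V × W)) (E : Finset (Sym2 V × W))
    (F : Finset (Sym2 W × V)) : Prop where
  none_mem : ∀ g h, f g h = none → (g, h) ∈ X
  left_mem : ∀ u v h, G.Adj u v → f u h = some true → f v h = some false → (s(u, v), h) ∈ E
  right_mem : ∀ g u v, H.Adj u v → f g u = some true → f g v = some false → (s(u, v), g) ∈ F
  exists_true : ∃ g h, f g h = some true
  exists_false : ∃ g h, f g h = some false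

namespace IsBoxCut

variable {V W : Type*} {G : SimpleGraph V} {H : SimpleGraph W} {f : V → W → Option Bool}
  {X : Finset (V × W)} {E : Finset (Sym2 V × W)} {F : Finset (Sym2 W × V)} {a b c d : ℕ}

theorem swap (hf : IsBoxCut G H f X E F) :
    IsBoxCut H G (fun h g => f g h) (X.map (Equiv.prodComm V W).toEmbedding) F E where
  none_mem h g hn := by simpa using hf.none_mem g h hn
  left_mem u v g := hf.right_mem g u v
  right_mem h u v := hf.left_mem u v h
  exists_true := let ⟨g, h, e⟩ := hf.exists_true; ⟨h, g, e⟩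
  exists_false := let ⟨g, h, e⟩ := hf.exists_false; ⟨h, g, e⟩

theorem map_not (hf : IsBoxCut G H f X E F) :
    IsBoxCut G H (fun g h => (f g h).map not) X E F where
  none_mem g h hn := hf.none_mem g h (by simpa using hn)
  left_mem u v h huv hu hv := by
    rw [Sym2.eq_swap]
    exact hf.left_mem v u h huv.symm (by simpa using hv) (by simpa using hu)
  right_mem g u v huv hu hv := by
    rw [Sym2.eq_swap]
    exact hf.right_mem g v u huv.symm (by simpa using hv) (by simpa using hu)
  exists_true := let ⟨g, h, e⟩ := hf.exists_false; ⟨g, h, by simp [e]⟩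
  exists_false := let ⟨g, h, e⟩ := hf.exists_true; ⟨g, h, by simp [e]⟩

open Classical in
/-- A bichromatic layer in the direction of `H` is cut by the removed elements in that layer. -/
theorem isMixedCut_right (hf : IsBoxCut G H f X E F) {g : V} (ht : ∃ h, f g h = some true)
    (hfa : ∃ h, f g h = some false) :
    IsMixedCut H (f g) ((X.filter fun x => x.1 = g).image Prod.snd)
      ((F.filter fun x => x.2 = g).image Prod.fst) where
  none_mem h hn := by simpa using hf.none_mem g h hn
  edge_mem u v huv hu hv := by simpa using hf.right_mem g u v huv hu hv
  exists_true := ht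
  exists_false := hfa

open Classical in
theorem isMixedCut_left (hf : IsBoxCut G H f X ∅ F) {h : W} (ht : ∃ g, f g h = some true)
    (hfa : ∃ g, f g h = some false) :
    IsMixedCut G (fun g => f g h) ((X.filter fun x => x.2 = h).image Prod.fst) ∅ where
  none_mem g hn := by simpa using hf.none_mem g h hn
  edge_mem u v huv hu hv := absurd (hf.left_mem u v h huv hu hv) (Finset.notMem_empty _)
  exists_true := ht
  exists_false := hfa

open Classical in
/-- If no edge in the direction of `G` is removed, a bichromatic `G`-layer contains more than `a`
removed vertices. -/
theorem lt_card_row (hG : CutConnected G a b) (hf : IsBoxCut G H f X ∅ F) {h : W}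
    (ht : ∃ g, f g h = some true) (hfa : ∃ g, f g h = some false) :
    a < (X.filter fun x => x.2 = h).card := by
  by_contra! hle
  have := hG.2 _ _ _ (hf.isMixedCut_left ht hfa) (Finset.card_image_le.trans hle)
  simp at this

/-- If some `G`-layer avoids the second colour and some `G`-layer avoids the first one, then no
`H`-layer is bichromatic. -/
theorem column_not_bichromatic (hG : CutConnected G a b) (hH : CutConnected H c 0)
    (hf : IsBoxCut G H f X E F) (hX : X.card ≤ a + c + 1) (hF : F.card ≤ b) {h₁ h₂ : W}
    (h1 : ∀ g, f g h₁ ≠ some false) (h2 : ∀ g, f g h₂ ≠ some true) {g₀ : V}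
    (ht : ∃ h, f g₀ h = some true) : ¬ ∃ h, f g₀ h = some false := by
  classical
  intro hfa
  obtain ⟨A, hA⟩ := hG.1
  have hXg := X.card_fiber_add_card_image_erase_le Prod.fst g₀
  have hFg := F.card_fiber_add_card_image_erase_le Prod.snd g₀
  -- Any other H-layer without removed vertices has both colours, at h₁ and h₂, hence a removed
  -- edge. This costs at least a + b + 1 elements, and cutting the layer of g₀ costs another c + 1.
  have hsub : A.erase g₀ ⊆ (X.image Prod.fst).erase g₀ ∪ (F.image Prod.snd).erase g₀ := by
    intro g hg
    have hne := Finset.ne_of_mem_erase hg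
    by_contra hgn
    simp only [Finset.mem_union, Finset.mem_erase, not_or, not_and] at hgn
    have hgX := hgn.1 hne
    have hgF := hgn.2 hne
    have hnn : ∀ h, f g h ≠ none := fun h hn =>
      hgX (Finset.mem_image.2 ⟨_, hf.none_mem g h hn, rfl⟩)
    have e1 : f g h₁ = some true := by
      rcases e : f g h₁ with _ | _ | _
      · exact absurd e (hnn _)
      · exact absurd e (h1 g)
      · rfl
    have e2 : f g h₂ = some false := by
      rcases e : f g h₂ with _ | _ | _
      · exact absurd e (hnn _)
      · rfl
      · exact absurd e (h2 g)
    have hx0 : X.filter (fun x => x.1 = g) = ∅ :=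
      Finset.filter_eq_empty_iff.2 fun x hx e => hgX (Finset.mem_image.2 ⟨x, hx, e⟩)
    have hf0 : F.filter (fun x => x.2 = g) = ∅ :=
      Finset.filter_eq_empty_iff.2 fun x hx e => hgF (Finset.mem_image.2 ⟨x, hx, e⟩)
    have := hH.2 _ _ _ (hf.isMixedCut_right ⟨h₁, e1⟩ ⟨h₂, e2⟩) (by simp [hx0])
    simp [hf0] at this
  have hcard := (Finset.card_le_card hsub).trans (Finset.card_union_le _ _)
  have hA' := Finset.pred_card_le_card_erase (s := A) (a := g₀)
  have hcut := hf.isMixedCut_right ht hfa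
  have i1 := Finset.card_image_le (s := X.filter fun x => x.1 = g₀) (f := Prod.snd)
  have i2 := Finset.card_image_le (s := F.filter fun x => x.2 = g₀) (f := Prod.fst)
  rcases le_or_gt ((X.filter fun x => x.1 = g₀).image Prod.snd).card c with hle | hlt
  · have := hH.lt_card_add_card hcut hle
    omega
  · omega

/-- If no edge in the direction of `G` is removed and some `G`-layer is bichromatic, then a
`G`-layer without removed vertices cannot contain the first colour. -/
theorem false_of_bichromatic_row (hG : CutConnected G a b) (hH : CutConnected H c 0)
    (hf : IsBoxCut G H f X ∅ F) (hX : X.card ≤ a + c + 1) (hF : F.card ≤ b) {h h₀ : W}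
    (ht : ∃ g, f g h = some true) (hfa : ∃ g, f g h = some false)
    (hh₀ : ∀ g, (g, h₀) ∉ X) (ht₀ : ∃ g, f g h₀ = some true) : False := by
  classical
  replace hh₀ : h₀ ∉ X.image Prod.snd := by simpa using hh₀
  have hrow := hf.lt_card_row hG ht hfa
  have hmono : ∀ h' ∉ X.image Prod.snd, (∃ g, f g h' = some true) → ∀ g, f g h' ≠ some false := by
    intro h' hh' ht' g hg
    have := hf.lt_card_row hG ht' ⟨g, hg⟩
    rw [Finset.filter_eq_empty_iff.2 fun x hx e => hh' (Finset.mem_image.2 ⟨x, hx, e⟩)] at this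
    simp at this
  have hnn : ∀ h' ∉ X.image Prod.snd, ∀ g, f g h' ≠ none := fun h' hh' g hn =>
    hh' (Finset.mem_image.2 ⟨_, hf.none_mem g h' hn, rfl⟩)
  -- Intact layers of opposite colours would create a bichromatic H-layer.
  have hall : ∀ h' ∉ X.image Prod.snd, ∀ g, f g h' = some true := by
    intro h' hh' g
    rcases e : f g h' with _ | _ | _
    · exact absurd e (hnn h' hh' g)
    · exfalso
      have h2 : ∀ g', f g' h' ≠ some true := fun g' hg' => hmono h' hh' ⟨g', hg'⟩ g e
      have e0 : f g h₀ = some true := by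
        rcases e' : f g h₀ with _ | _ | _
        · exact absurd e' (hnn h₀ hh₀ g)
        · exact absurd e' (hmono h₀ hh₀ ht₀ g)
        · rfl
      exact hf.column_not_bichromatic hG hH hX hF (hmono h₀ hh₀ ht₀) h2 ⟨h₀, e0⟩ ⟨h', e⟩
    · rfl
  have hXh := X.card_fiber_add_card_image_erase_le Prod.snd h
  set r := ((X.image Prod.snd).erase h).card
  -- Of the more than c H-neighbours of (g, h), those in intact layers have the first colour, so
  -- their edges to (g, h) are removed.
  have hdeg : ∀ g, f g h = some false → c < r + (F.filter fun x => x.2 = g).card := by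
    intro g hg
    have hinj : Function.Injective fun h' : W => (s(h', h), g) := by
      intro u v huv
      simp only [Prod.mk.injEq, Sym2.eq_iff] at huv
      grind
    have := hH.lt_card_of_neighbor_mem h ((X.image Prod.snd).erase h ∪
      (F.filter fun x => x.2 = g).preimage _ hinj.injOn) fun h' hadj => ?_
    · refine lt_of_lt_of_le this ((Finset.card_union_le _ _).trans ?_)
      rw [Finset.card_preimage]
      gcongr
      exact Finset.filter_subset _ _
    · rw [Finset.mem_union]
      by_cases hh' : h' ∈ X.image Prod.snd
      · exact Or.inl (Finset.mem_erase.2 ⟨hadj.ne', hh'⟩)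
      · exact Or.inr (by simpa using hf.right_mem g h' h hadj.symm (hall h' hh' g) hg)
  obtain ⟨g₂, hg₂⟩ := hfa
  set T := (F.image Prod.snd).filter fun g => f g h = some false
  have hT : ∀ g, f g h = some false → g ∈ T := by
    intro g hg
    have := hdeg g hg
    have hpos : 0 < (F.filter fun x => x.2 = g).card := by omega
    obtain ⟨x, hx⟩ := Finset.card_pos.1 hpos
    rw [Finset.mem_filter] at hx
    exact Finset.mem_filter.2 ⟨Finset.mem_image.2 ⟨x, hx⟩, hg⟩
  have hFT : T.card * (c + 1 - r) ≤ F.card := by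
    calc T.card * (c + 1 - r) ≤ ∑ g ∈ T, (F.filter fun x => x.2 = g).card := by
          rw [← smul_eq_mul]
          refine Finset.card_nsmul_le_sum _ _ _ fun g hg => ?_
          have := hdeg g (Finset.mem_filter.1 hg).2
          omega
      _ ≤ F.card := by
          rw [Finset.sum_card_fiberwise_eq_card_filter F T Prod.snd]
          exact Finset.card_filter_le _ _
  -- No G-edge is removed, so a neighbour of g₂ in layer h is a removed vertex or lies in `T`.
  have hnbr := hG.lt_card_of_neighbor_mem g₂
    ((X.filter fun x => x.2 = h).image Prod.fst ∪ T.erase g₂) ?_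
  · have h1 := hnbr.trans_le (Finset.card_union_le _ _)
    have h2 := Finset.card_image_le (s := X.filter fun x => x.2 = h) (f := Prod.fst)
    rw [Finset.card_erase_of_mem (hT g₂ hg₂)] at h1
    have hTpos : 0 < T.card := Finset.card_pos.2 ⟨g₂, hT g₂ hg₂⟩
    obtain ⟨s, hs⟩ : ∃ s, c + 1 - r = s + 1 := ⟨c - r, by omega⟩
    rw [hs] at hFT
    -- t(s + 1) ≥ t + s because t ≥ 1.
    have : T.card + s ≤ F.card := by nlinarith
    omega
  · intro g hadj
    rw [Finset.mem_union]
    rcases e : f g h with _ | _ | _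
    · exact Or.inl (by simpa using hf.none_mem g h e)
    · exact Or.inr (Finset.mem_erase.2 ⟨hadj.ne', hT g e⟩)
    · exact absurd (hf.left_mem g g₂ h hadj.symm e hg₂) (Finset.notMem_empty _)

/-- There is no small cut of a product all of whose edges are in the direction of `H`. -/
theorem false_of_left_empty (hG : CutConnected G a b) (hH : CutConnected H c 0)
    (hf : IsBoxCut G H f X ∅ F) (hX : X.card ≤ a + c + 1) (hF : F.card ≤ b) : False := by
  classical
  by_cases hrow : ∃ h, (∃ g, f g h = some true) ∧ ∃ g, f g h = some false
  · obtain ⟨h, ht, hfa⟩ := hrow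
    have hlt := hf.lt_card_row hG ht hfa
    have hXh := X.card_fiber_add_card_image_erase_le Prod.snd h
    have hr := Finset.pred_card_le_card_erase (s := X.image Prod.snd) (a := h)
    obtain ⟨B, hB⟩ := hH.1
    -- At most c removed vertices lie outside layer h, so at most c + 1 of the at least c + 2 layers
    -- are hit.
    obtain ⟨h₀, -, hh₀⟩ := Finset.exists_mem_notMem_of_card_lt_card
      (by omega : (X.image Prod.snd).card < B.card)
    obtain ⟨g, hg⟩ := ht
    have hh₀' : ∀ g, (g, h₀) ∉ X := by simpa using hh₀
    rcases e : f g h₀ with _ | _ | _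
    · exact hh₀ (Finset.mem_image.2 ⟨_, hf.none_mem g h₀ e, rfl⟩)
    · obtain ⟨g', hg'⟩ := hfa
      exact hf.map_not.false_of_bichromatic_row hG hH hX hF (h := h) ⟨g', by simp [hg']⟩
        ⟨g, by simp [hg]⟩ hh₀' ⟨g, by simp [e]⟩
    · exact hf.false_of_bichromatic_row hG hH hX hF ⟨g, hg⟩ hfa hh₀' ⟨g, e⟩
  · push Not at hrow
    obtain ⟨g₁, h₁, e₁⟩ := hf.exists_true
    obtain ⟨g₂, h₂, e₂⟩ := hf.exists_false
    have hcol : ∀ g, (∃ h, f g h = some true) → ∀ h, f g h ≠ some false := by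
      intro g ht h hfa
      exact hf.column_not_bichromatic hG hH hX hF (hrow h₁ ⟨g₁, e₁⟩)
        (fun g' hg' => hrow h₂ ⟨g', hg'⟩ g₂ e₂) ht ⟨h, hfa⟩
    obtain ⟨A, hA⟩ := hG.1
    obtain ⟨B, hB⟩ := hH.1
    -- Disjoint parts of `X` meet a + b H-layers off g₁, g₂ and, on g₁ or g₂, c + 2 G-layers: more
    -- than a + c + 1 vertices.
    have hAX : (A.erase g₁).erase g₂ ⊆
        (X.filter fun x => ¬ (x.1 = g₁ ∨ x.1 = g₂)).image Prod.fst := by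
      intro g hg
      simp only [Finset.mem_erase] at hg
      have key : ∃ h, f g h = none := by
        rcases e : f g h₁ with _ | _ | _
        · exact ⟨_, e⟩
        · exact absurd e (hrow h₁ ⟨g₁, e₁⟩ g)
        · rcases e' : f g h₂ with _ | _ | _
          · exact ⟨_, e'⟩
          · exact absurd e' (hcol g ⟨_, e⟩ h₂)
          · exact absurd e₂ (hrow h₂ ⟨g, e'⟩ g₂)
      obtain ⟨h, hn⟩ := key
      exact Finset.mem_image.2 ⟨(g, h), Finset.mem_filter.2
        ⟨hf.none_mem g h hn, by simp [hg.1, hg.2.1]⟩, rfl⟩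
    have hBX : B ⊆ (X.filter fun x => x.1 = g₁ ∨ x.1 = g₂).image Prod.snd := by
      intro h _
      rcases e : f g₁ h with _ | _ | _
      · exact Finset.mem_image.2 ⟨(g₁, h), Finset.mem_filter.2
          ⟨hf.none_mem _ h e, by simp⟩, rfl⟩
      · exact absurd e (hcol g₁ ⟨_, e₁⟩ h)
      · rcases e' : f g₂ h with _ | _ | _
        · exact Finset.mem_image.2 ⟨(g₂, h), Finset.mem_filter.2
            ⟨hf.none_mem _ h e', by simp⟩, rfl⟩
        · exact absurd e' (hrow h ⟨_, e⟩ g₂)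
        · exact absurd e₂ (hcol g₂ ⟨_, e'⟩ h₂)
    have h1 := (Finset.card_le_card hAX).trans Finset.card_image_le
    have h2 := (Finset.card_le_card hBX).trans Finset.card_image_le
    have h3 := Finset.pred_card_le_card_erase (s := A) (a := g₁)
    have h4 := Finset.pred_card_le_card_erase (s := A.erase g₁) (a := g₂)
    have h5 := Finset.card_filter_add_card_filter_not (s := X) fun x => x.1 = g₁ ∨ x.1 = g₂
    omega

-- All copies of e leave the product, but only one removed edge has to be credited; other copies may
-- stay in `E` harmlessly.
open Classical in
theorem erase_left {e : Sym2 V} {h₀ : W} (hf : IsBoxCut G H f X E F) :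
    IsBoxCut (G.deleteEdges {e}) H f X (E.erase (e, h₀)) F where
  none_mem := hf.none_mem
  left_mem u v h huv hu hv := by
    rw [SimpleGraph.deleteEdges_adj] at huv
    refine Finset.mem_erase.2 ⟨fun he => huv.2 (Prod.ext_iff.1 he).1, hf.left_mem u v h huv.1 hu hv⟩
  right_mem := hf.right_mem
  exists_true := hf.exists_true
  exists_false := hf.exists_false

open Classical in
theorem erase_right {e : Sym2 W} {g₀ : V} (hf : IsBoxCut G H f X E F) :
    IsBoxCut G (H.deleteEdges {e}) f X E (F.erase (e, g₀)) where
  none_mem := hf.none_mem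
  left_mem := hf.left_mem
  right_mem := hf.swap.erase_left.swap.right_mem
  exists_true := hf.exists_true
  exists_false := hf.exists_false

/-- The product of graphs withstanding the removal of `(a, b)` and `(c, d)` vertices and edges
withstands the removal of `a + c + 1` vertices and `b + d` edges. -/
theorem false_of_card_le (hG : CutConnected G a b) (hH : CutConnected H c d)
    (hf : IsBoxCut G H f X E F) (hX : X.card ≤ a + c + 1) (hEF : E.card + F.card ≤ b + d) :
    False := by
  classical
  induction hn : b + d generalizing b d G H E F with
  | zero =>
    have hE : E = ∅ := Finset.card_eq_zero.1 (by omega)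
    subst hE
    exact hf.false_of_left_empty hG (hH.mono_right (Nat.zero_le d)) hX (by omega)
  | succ n ih =>
    have hleft : E.Nonempty → b = 0 := by
      rintro ⟨⟨e, h₀⟩, he⟩
      by_contra hb
      obtain ⟨b, rfl⟩ := Nat.exists_eq_succ_of_ne_zero hb
      refine ih (hG.deleteEdge e) hH (hf.erase_left (h₀ := h₀)) ?_ (by omega)
      have := Finset.card_pos.2 ⟨_, he⟩
      rw [Finset.card_erase_of_mem he]
      omega
    have hright : F.Nonempty → d = 0 := by
      rintro ⟨⟨e, g₀⟩, he⟩
      by_contra hd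
      obtain ⟨d, rfl⟩ := Nat.exists_eq_succ_of_ne_zero hd
      refine ih hG (hH.deleteEdge e) (hf.erase_right (g₀ := g₀)) ?_ (by omega)
      have := Finset.card_pos.2 ⟨_, he⟩
      rw [Finset.card_erase_of_mem he]
      omega
    rcases E.eq_empty_or_nonempty with rfl | hE
    · refine hf.false_of_left_empty hG (hH.mono_right (Nat.zero_le d)) hX ?_
      rcases F.eq_empty_or_nonempty with rfl | hF
      · simp
      · have := hright hF
        simp at hEF
        omega
    · have hb := hleft hE
      rcases F.eq_empty_or_nonempty with rfl | hF
      · refine hf.swap.false_of_left_empty hH (hG.mono_right (Nat.zero_le b)) ?_ ?_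
        · rw [Finset.card_map]; omega
        · simp at hEF
          omega
      · have := hright hF
        omega

end IsBoxCut

/-! ### Budgets of products of two and of n graphs -/

open SimpleGraph in
theorem CutConnected.boxProd {V W : Type*} {G : SimpleGraph V} {H : SimpleGraph W} {a b c d : ℕ}
    (hG : CutConnected G a b) (hH : CutConnected H c d) :
    CutConnected (G □ H) (a + c + 1) (b + d) := by
  classical
  refine ⟨?_, fun f X Y hf hX => ?_⟩
  · obtain ⟨A, hA⟩ := hG.1
    obtain ⟨B, hB⟩ := hH.1
    exact ⟨A ×ˢ B, by rw [Finset.card_product]; nlinarith⟩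
  by_contra! hY
  have hi : Function.Injective fun x : Sym2 V × W => x.1.map fun g => (g, x.2) := by
    rintro ⟨⟨u, v⟩, h⟩ ⟨⟨u', v'⟩, h'⟩ hx
    simp at hx ⊢
    grind
  have hj : Function.Injective fun x : Sym2 W × V => x.1.map fun h => (x.2, h) := by
    rintro ⟨⟨u, v⟩, h⟩ ⟨⟨u', v'⟩, h'⟩ hx
    simp at hx ⊢
    grind
  -- `Y` may contain loops, which would be counted in both directions; they are kept in `F` only.
  set E := (Y.preimage _ hi.injOn).filter fun x => ¬ x.1.IsDiag
  set F := Y.preimage _ hj.injOn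
  have hcut : IsBoxCut G H (fun g h => f (g, h)) X E F := by
    refine ⟨fun g h => hf.none_mem (g, h), fun u v h huv hu hv => ?_, fun g u v huv hu hv => ?_,
      ?_, ?_⟩
    · have := hf.edge_mem (u, h) (v, h) (by simp [huv]) hu hv
      simpa [E, huv.ne] using this
    · have := hf.edge_mem (g, u) (g, v) (by simp [huv]) hu hv
      simpa [F] using this
    · obtain ⟨⟨g, h⟩, e⟩ := hf.exists_true
      exact ⟨g, h, e⟩
    · obtain ⟨⟨g, h⟩, e⟩ := hf.exists_false
      exact ⟨g, h, e⟩
  refine hcut.false_of_card_le hG hH hX (le_trans ?_ hY)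
  rw [← Finset.card_map ⟨_, hi⟩, ← Finset.card_map (s := F) ⟨_, hj⟩, ← Finset.card_union_of_disjoint]
  · refine Finset.card_le_card (Finset.union_subset ?_ ?_)
    · intro y hy
      simp only [E, Finset.mem_map, Finset.mem_filter, Finset.mem_preimage] at hy
      obtain ⟨x, hx, rfl⟩ := hy
      exact hx.1
    · intro y hy
      simp only [F, Finset.mem_map, Finset.mem_preimage] at hy
      obtain ⟨x, hx, rfl⟩ := hy
      exact hx
  · rw [Finset.disjoint_left]
    intro y hy hy'
    simp only [E, F, Finset.mem_map, Finset.mem_filter, Finset.mem_preimage] at hy hy'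
    obtain ⟨⟨⟨u, v⟩, h⟩, ⟨-, hne⟩, rfl⟩ := hy
    obtain ⟨⟨⟨u', v'⟩, h'⟩, -, hx⟩ := hy'
    simp at hx hne
    grind

open SimpleGraph in
/-- The Cartesian product of `n + 1` graphs is the product of the first with that of the others. -/
def cartesianProductConsIso {n : ℕ} {V : Fin (n + 1) → Type*} (G : ∀ i, SimpleGraph (V i)) :
    (G 0 □ cartesianProduct fun i : Fin n => G i.succ) ≃g cartesianProduct G where
  toEquiv := Fin.consEquiv V
  map_rel_iff' {x y} := by
    obtain ⟨x₀, x⟩ := x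
    obtain ⟨y₀, y⟩ := y
    simp only [cartesianProduct, boxProd_adj, Fin.exists_fin_succ, Fin.consEquiv_apply,
      Fin.cons_zero, Fin.cons_succ, Fin.forall_fin_succ, funext_iff]
    simp [Fin.succ_ne_zero, (Fin.succ_ne_zero _).symm]
    tauto

/-- The Cartesian product of a one-element family is its only member. -/
def cartesianProductUniqueIso {V : Fin 1 → Type*} (G : ∀ i, SimpleGraph (V i)) :
    G 0 ≃g cartesianProduct G where
  toEquiv := (Equiv.piUnique V).symm
  map_rel_iff' {x y} := by
    simp only [cartesianProduct, Fin.exists_fin_one, Fin.forall_fin_one]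
    exact ⟨fun h => h.1, fun h => ⟨h, fun h0 => absurd rfl h0⟩⟩

/-- Each of the n binary products contributes one extra vertex. -/
theorem CutConnected.cartesianProduct {n : ℕ} {V : Fin (n + 1) → Type*}
    {G : ∀ i, SimpleGraph (V i)} {a b : Fin (n + 1) → ℕ} (hG : ∀ i, CutConnected (G i) (a i) (b i)) :
    CutConnected (cartesianProduct G) ((∑ i, a i) + n) (∑ i, b i) := by
  induction n with
  | zero => simpa using (hG 0).of_iso (cartesianProductUniqueIso G)
  | succ n ih =>
    have := ((hG 0).boxProd (ih fun i => hG i.succ)).of_iso (cartesianProductConsIso G)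
    rw [Fin.sum_univ_succ a, Fin.sum_univ_succ b]
    convert this using 1
    omega

/-! ### Translation to mixed connectedness and conclusion -/

theorem mixedConnected_succ_iff {V : Type*} {G : SimpleGraph V} {p q : ℕ} :
    MixedConnected G p (q + 1) ↔ CutConnected G p q := by
  simp [MixedConnected, CutConnected.iff_removeElements_connected, add_assoc]

theorem mixedConnected_succ_zero_iff {V : Type*} {G : SimpleGraph V} {p : ℕ} :
    MixedConnected G (p + 1) 0 ↔ CutConnected G p 0 := by
  simp only [MixedConnected, CutConnected.iff_removeElements_connected, add_zero,
    Nat.add_sub_cancel, lt_irrefl, false_and, or_false, true_and, Nat.succ_pos]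
  refine and_congr_right fun _ => ⟨fun h X Y _ hX hY => ?_, fun h X hX => ?_⟩
  · obtain rfl := Finset.card_eq_zero.1 (Nat.le_zero.1 hY)
    simpa using h X hX
  · simpa using h X ∅ (by simp) hX (by simp)

theorem MixedConnected.cutConnected {V : Type*} {G : SimpleGraph V} {p q : ℕ}
    (h : MixedConnected G p q) : CutConnected G (if 0 < q then p else p - 1) (q - 1) := by
  rcases q with _ | q
  · rcases p with _ | p
    · simp [MixedConnected] at h
    · simpa using mixedConnected_succ_zero_iff.1 h
  · simpa using mixedConnected_succ_iff.1 h

theorem corollary4p7 {n : ℕ} (hn : 0 < n) {V : Fin n → Type*}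
    (G : ∀ i, SimpleGraph (V i)) (p q : Fin n → ℕ)
    (hG : ∀ i, MixedConnected (G i) (p i) (q i))
    (k : ℕ) (hk : k = (Finset.univ.filter fun i => 0 < q i).card) :
    MixedConnected (cartesianProduct G) (∑ i, p i) (∑ i, q i) ∧
      (1 ≤ k →
        MixedConnected (cartesianProduct G) ((∑ i, p i) + k - 1) ((∑ i, q i) - k + 1)) := by
  obtain ⟨n, rfl⟩ := Nat.exists_eq_succ_of_ne_zero hn.ne'
  have hcut := CutConnected.cartesianProduct fun i => (hG i).cutConnected
  have hpos : ∀ i, 0 < p i ∨ 0 < q i := by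
    intro i
    rcases (hG i).2 with h | h
    · exact Or.inl h.2.1
    · exact Or.inr h.1
  -- Exactly the n + 1 - k factors with q i = 0 lose a vertex in the translation.
  have hp : (∑ i, if 0 < q i then p i else p i - 1) + (n + 1) = (∑ i, p i) + k := by
    have hcard : (n + 1 : ℕ) = ∑ _i : Fin (n + 1), 1 := by simp
    rw [hk, Finset.card_filter, hcard, ← Finset.sum_add_distrib, ← Finset.sum_add_distrib]
    refine Finset.sum_congr rfl fun i _ => ?_
    have := hpos i
    split_ifs <;> omega
  have hq : (∑ i, (q i - 1)) + k = ∑ i, q i := by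
    rw [hk, Finset.card_filter, ← Finset.sum_add_distrib]
    refine Finset.sum_congr rfl fun i _ => ?_
    split_ifs <;> omega
  rcases k with _ | k
  · refine ⟨?_, by omega⟩
    have hq0 : ∑ i, q i = 0 := by
      refine Finset.sum_eq_zero fun i _ => ?_
      have := Finset.filter_eq_empty_iff.1 (Finset.card_eq_zero.1 hk.symm) (Finset.mem_univ i)
      omega
    have hp' : ∑ i, p i = ((∑ i, if 0 < q i then p i else p i - 1) + n) + 1 := by omega
    rw [hq0, hp', mixedConnected_succ_zero_iff]
    rwa [show ∑ i, (q i - 1) = 0 by omega] at hcut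
  · have hp' : (∑ i, if 0 < q i then p i else p i - 1) + n = (∑ i, p i) + k := by omega
    rw [hp'] at hcut
    refine ⟨?_, fun _ => ?_⟩
    · have := mixedConnected_succ_iff.2 (hcut.shift_add k)
      rwa [add_assoc, hq] at this
    · rw [← hq, Nat.add_sub_cancel]
      exact mixedConnected_succ_iff.2 hcut
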